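/- **Theorem 2.1.** Consider a one-parameter exponential family in canonical form: for each $\theta$ in an open interval $\Theta\subseteq\mathbb R$, $p(y\mid\theta)=q(y)\exp(y\theta-b(\theta))$ is a probability density with respect to a fixed dominating measure on $\mathbb R$, where $q\ge 0$; write $\dot b=\partial_\theta b$. For a sample $D=(y_1,\dots,y_n)$ modelled as i.i.d. from this family let $L(\theta\mid D)=\prod_{i=1}^n p(y_i\mid\theta)$. Let $n\to\infty$ along a sequence of sample sizes, and let $n_0$ satisfy $n_0/n=r$ with $r>0$ a constant. For each such $n$ let $D=(y_1,\dots,y_n)$ (current data) and $D_0=(y_{01},\dots,y_{0n_0})$ (historical data) be observed samples, with $q>0$ at every observation and with sample means $\bar y,\bar y_0$ in $\dot b(\Theta)$. Suppose that, for a fixed finite $\delta>0$, $$|\dot b^{-1}(\bar y)-\dot b^{-1}(\bar y_0)|=\delta\quad\text{for all these } n ,$$ and that, as $n\to\infty$, the estimates $\dot b^{-1}(\bar y)$ and $\dot b^{-1}(\bar y_0)$ each converge to a point of $\Theta$. Let $\pi_0\ge 0$ be a (possibly improper) initial prior density on $\Theta$ that is positive and continuous at these two limits and for which $c(a_0)=\int_\Theta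 L(\theta\mid D_0)^{a_0}\pi_0(\theta)\,d\theta$ is finite for every $0<a_0\le 1$ and every $n$ (this is automatic if $\pi_0$ is proper). Let $\alpha_0,\beta_0>0$, let $\pi(a_0)$ be the $\operatorname{beta}(\alpha_0,\beta_0)$ density (zero outside $(0,1)$), and let $$\pi(a_0\mid D,D_0,\alpha_0,\beta_0)\ \propto\ \int_\Theta L(\theta\mid D)\,\frac{L(\theta\mid D_0)^{a_0}\pi_0(\theta)}{c(a_0)}\,\pi(a_0)\,d\theta$$ be the marginal posterior density of $a_0$ under the normalized power prior. Then it converges to a point mass at $0$; that is, for every $\epsilon>0$, $$\lim_{n\to\infty}\frac{\int_0^{\epsilon}\pi(a_0\mid D,D_0,\alpha_0,\beta_0)\,da_0}{\int_0^1\pi(a_0\mid D,D_0,\alpha_0,\beta_0)\,da_0}=1 .$$ -/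

import Mathlib

open Filter Topology MeasureTheory

noncomputable section

namespace NPP

/-- A one-parameter exponential family in canonical form on the real line: with respect to a
dominating measure `ν` (Lebesgue measure, counting measure on a discrete set, ...), the density at
parameter `θ` is `q y * exp (y * θ - b θ)`, where `θ` ranges over an open interval `Θ`.
The field `lintegral_eq_one` says that this is a probability density for every `θ ∈ Θ`. -/
structure ExpFamily where
  ν : Measure ℝ
  q : ℝ → ℝ
  b : ℝ → ℝ
  Θ : Set ℝ
  isOpen_Θ : IsOpen Θ
  ordConnected_Θ : Θ.OrdConnected
  measurable_q : Measurable q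
  q_nonneg : ∀ y, 0 ≤ q y
  lintegral_eq_one : ∀ θ ∈ Θ, ∫⁻ y, ENNReal.ofReal (q y * Real.exp (y * θ - b θ)) ∂ν = 1

/-- The density `p(y | θ)` of a single observation. -/
def ExpFamily.density (F : ExpFamily) (θ y : ℝ) : ℝ :=
  F.q y * Real.exp (y * θ - F.b θ)

/-- The likelihood `L(θ | D)` of a sample `D = (y₁, …, yₙ)` of i.i.d. observations. -/
def ExpFamily.likelihood (F : ExpFamily) {n : ℕ} (y : Fin n → ℝ) (θ : ℝ) : ℝ :=
  ∏ i, F.density θ (y i)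

/-- The sample mean. -/
def sampleMean {n : ℕ} (y : Fin n → ℝ) : ℝ :=
  (∑ i, y i) / n

/-- The estimate `ḃ⁻¹(ȳ)` of the canonical parameter: the inverse of the derivative of `b`, as a
map on the parameter space, evaluated at `ȳ`. It is meaningful for `ȳ ∈ ḃ(Θ)`. -/
def ExpFamily.canonicalEstimate (F : ExpFamily) (ybar : ℝ) : ℝ :=
  Function.invFunOn (deriv F.b) F.Θ ybar

/-- The normalizing function `c(a₀) = ∫ L(θ | D₀) ^ a₀ π₀(θ) dθ`. -/
def ExpFamily.normConst (F : ExpFamily) (π₀ : ℝ → ℝ) {n₀ : ℕ} (y₀ : Fin n₀ → ℝ) (a₀ : ℝ) : ℝ :=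
  ∫ θ in F.Θ, F.likelihood y₀ θ ^ a₀ * π₀ θ

/-- The normalized power prior `π(θ, a₀ | D₀) = L(θ | D₀) ^ a₀ π₀(θ) / c(a₀) · π(a₀)` with a
`beta(α₀, β₀)` prior on `a₀` (its density vanishes outside `(0, 1)`). -/
def ExpFamily.normalizedPowerPrior (F : ExpFamily) (π₀ : ℝ → ℝ) (α₀ β₀ : ℝ)
    {n₀ : ℕ} (y₀ : Fin n₀ → ℝ) (θ a₀ : ℝ) : ℝ :=
  F.likelihood y₀ θ ^ a₀ * π₀ θ / F.normConst π₀ y₀ a₀ * ProbabilityTheory.betaPDFReal α₀ β₀ a₀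

/-- The unnormalized marginal posterior `∫ L(θ | D) π(θ, a₀ | D₀) dθ` of `a₀`. -/
def ExpFamily.marginalKernel (F : ExpFamily) (π₀ : ℝ → ℝ) (α₀ β₀ : ℝ)
    {n n₀ : ℕ} (y : Fin n → ℝ) (y₀ : Fin n₀ → ℝ) (a₀ : ℝ) : ℝ :=
  ∫ θ in F.Θ, F.likelihood y θ * F.normalizedPowerPrior π₀ α₀ β₀ y₀ θ a₀

/-- The marginal posterior density `π(a₀ | D, D₀, α₀, β₀)` of the discounting parameter. -/
def ExpFamily.marginalPosterior (F : ExpFamily) (π₀ : ℝ → ℝ) (α₀ β₀ : ℝ)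
    {n n₀ : ℕ} (y : Fin n → ℝ) (y₀ : Fin n₀ → ℝ) (a₀ : ℝ) : ℝ :=
  F.marginalKernel π₀ α₀ β₀ y y₀ a₀ / ∫ a in (0 : ℝ)..1, F.marginalKernel π₀ α₀ β₀ y y₀ a

end NPP

end

open Filter Topology MeasureTheory

noncomputable section

namespace NPP

/-! Write t and t₀ for the two estimates. An exponential family likelihood equals its maximum times
exp(-n B(t, θ)), where B is the Bregman divergence of `b`. In the normalized power prior the maximum
of L(θ | D₀)^a cancels against c(a). With E = B(t, ·) and H = r B(t₀, ·), the marginal posterior of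
a is therefore proportional to the beta density times the mean of exp(-n E) under the probability
density proportional to exp(-n a H) π₀ (`marginalKernel_eq`, `gibbsMean`).

Since E and H vanish at points a distance δ apart, E + aH is bounded below by a positive constant
once a ≥ ε, so this mean is exponentially small there (`gibbsMean_le`). Near the minimum of E the
quantity E + aH is as small as desired when a is small, so the mean decays at an arbitrarily slower
exponential rate on some interval [s/2, s] (`le_gibbsMean`). Comparing the two rates shows that the
mass of [ε, 1] is negligible (`eventually_integral_gibbsMean_le`).

Two points need care. The estimates move with the sample, so all bounds on B must be uniform over
base points near the limit. The prior may be improper, so the normalizer ∫ exp(-n a H) π₀ must be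
bounded above uniformly in n; `exists_mul_bregman_sub_le` reduces this to the finiteness of c(1) for
one sample. -/

/-- The base measure `q dν` of the family, whose cumulant generating function is `b` on `Θ`. -/
def ExpFamily.baseMeasure (F : ExpFamily) : Measure ℝ :=
  F.ν.withDensity fun y => ENNReal.ofReal (F.q y)

/-! ### Analyticity and convexity of the cumulant function, and its divergence -/

namespace ExpFamily

variable (F : ExpFamily)

theorem lintegral_exp_baseMeasure {θ : ℝ} (hθ : θ ∈ F.Θ) :
    ∫⁻ y, ENNReal.ofReal (Real.exp (θ * y)) ∂F.baseMeasure = ENNReal.ofReal (Real.exp (F.b θ)) := by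
  have hm : Measurable fun y => ENNReal.ofReal (F.q y) := F.measurable_q.ennreal_ofReal
  have hg : Measurable fun y : ℝ => ENNReal.ofReal (Real.exp (θ * y)) := by fun_prop
  rw [baseMeasure, lintegral_withDensity_eq_lintegral_mul _ hm hg]
  have hpt : ∀ y, ((fun y => ENNReal.ofReal (F.q y)) * fun y => ENNReal.ofReal (Real.exp (θ * y))) y
      = ENNReal.ofReal (Real.exp (F.b θ)) *
        ENNReal.ofReal (F.q y * Real.exp (y * θ - F.b θ)) := by
    intro y
    rw [Pi.mul_apply, ← ENNReal.ofReal_mul (F.q_nonneg y), ← ENNReal.ofReal_mul (Real.exp_nonneg _),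
      mul_left_comm, ← Real.exp_add]
    ring_nf
  simp_rw [hpt]
  rw [lintegral_const_mul' _ _ ENNReal.ofReal_ne_top, F.lintegral_eq_one θ hθ, mul_one]

theorem integrable_exp_baseMeasure {θ : ℝ} (hθ : θ ∈ F.Θ) :
    Integrable (fun y => Real.exp (θ * y)) F.baseMeasure := by
  refine ⟨by fun_prop, ?_⟩
  rw [hasFiniteIntegral_iff_ofReal (ae_of_all _ fun y => Real.exp_nonneg _),
    F.lintegral_exp_baseMeasure hθ]
  exact ENNReal.ofReal_lt_top

theorem subset_interior_integrableExpSet :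
    F.Θ ⊆ interior (ProbabilityTheory.integrableExpSet id F.baseMeasure) :=
  interior_maximal (fun _ hθ => F.integrable_exp_baseMeasure hθ) F.isOpen_Θ

/-- Normalization of the densities says exactly that exp(b) is the Laplace transform of the base
measure on Θ. As Θ is open, it lies in the interior of the domain of that transform, so smoothness
of `b` comes for free. -/
theorem eqOn_cgf : Set.EqOn F.b (ProbabilityTheory.cgf id F.baseMeasure) F.Θ := by
  intro θ hθ
  rw [ProbabilityTheory.cgf, ProbabilityTheory.mgf,
    integral_eq_lintegral_of_nonneg_ae (ae_of_all _ fun y => Real.exp_nonneg _) (by fun_prop)]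
  simp only [id]
  rw [F.lintegral_exp_baseMeasure hθ, ENNReal.toReal_ofReal (Real.exp_nonneg _), Real.log_exp]

theorem eventuallyEq_cgf {θ : ℝ} (hθ : θ ∈ F.Θ) :
    F.b =ᶠ[𝓝 θ] ProbabilityTheory.cgf id F.baseMeasure :=
  F.eqOn_cgf.eventuallyEq_of_mem (F.isOpen_Θ.mem_nhds hθ)

theorem analyticOnNhd_b : AnalyticOnNhd ℝ F.b F.Θ := fun _ hθ =>
  (ProbabilityTheory.analyticAt_cgf (F.subset_interior_integrableExpSet hθ)).congr
    (F.eventuallyEq_cgf hθ).symm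

theorem convex_Θ : Convex ℝ F.Θ := F.ordConnected_Θ.convex

/-- The second derivative of a cumulant generating function is a variance under the tilted measure.
-/
theorem convexOn_b : ConvexOn ℝ F.Θ F.b := by
  refine convexOn_of_deriv2_nonneg' F.convex_Θ F.analyticOnNhd_b.differentiableOn
    F.analyticOnNhd_b.deriv.differentiableOn fun θ hθ => ?_
  have h2 : deriv^[2] F.b θ =
      iteratedDeriv 2 (ProbabilityTheory.cgf id F.baseMeasure) θ := by
    rw [← iteratedDeriv_eq_iterate]
    exact (F.eventuallyEq_cgf hθ).iteratedDeriv_eq 2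
  rw [h2, ProbabilityTheory.iteratedDeriv_two_cgf_eq_integral
    (F.subset_interior_integrableExpSet hθ)]
  exact div_nonneg (integral_nonneg fun y => by positivity) ProbabilityTheory.mgf_nonneg

theorem monotoneOn_deriv_b : MonotoneOn (deriv F.b) F.Θ :=
  F.convexOn_b.monotoneOn_deriv fun θ hθ => (F.analyticOnNhd_b θ hθ).differentiableAt

/-- If the monotone derivative took equal values at u < v, it would be constant on [u, v], hence on
all of Θ by the identity theorem for analytic functions. Two distinct values thus exclude a
degenerate base measure. -/
theorem strictMonoOn_deriv_b {s t : ℝ} (hs : s ∈ F.Θ) (ht : t ∈ F.Θ)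
    (hst : deriv F.b s ≠ deriv F.b t) : StrictMonoOn (deriv F.b) F.Θ := by
  intro u hu v hv huv
  refine lt_of_le_of_ne (F.monotoneOn_deriv_b hu hv huv.le) fun heq => hst ?_
  have hsub : Set.Icc u v ⊆ F.Θ := F.ordConnected_Θ.out hu hv
  have hmid : (u + v) / 2 ∈ F.Θ := hsub ⟨by linarith, by linarith⟩
  have hev : deriv F.b =ᶠ[𝓝 ((u + v) / 2)] fun _ => deriv F.b u := by
    filter_upwards [Icc_mem_nhds (show u < (u + v) / 2 by linarith)
      (show (u + v) / 2 < v by linarith)] with x hx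
    exact le_antisymm ((F.monotoneOn_deriv_b (hsub hx) hv hx.2).trans heq.ge)
      (F.monotoneOn_deriv_b hu (hsub hx) hx.1)
  have hE := F.analyticOnNhd_b.deriv.eqOn_of_preconnected_of_eventuallyEq analyticOnNhd_const
    F.convex_Θ.isPreconnected hmid hev
  exact (hE hs).trans (hE ht).symm

theorem canonicalEstimate_mem {x : ℝ} (hx : x ∈ deriv F.b '' F.Θ) :
    F.canonicalEstimate x ∈ F.Θ := Function.invFunOn_mem hx

theorem deriv_b_canonicalEstimate {x : ℝ} (hx : x ∈ deriv F.b '' F.Θ) :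
    deriv F.b (F.canonicalEstimate x) = x := Function.invFunOn_eq hx

/-- The Bregman divergence of `b`: the Kullback-Leibler divergence of the member at `θ` from the
member at `t`. -/
def bregman (t θ : ℝ) : ℝ := F.b θ - F.b t - deriv F.b t * (θ - t)

theorem bregman_nonneg {t θ : ℝ} (ht : t ∈ F.Θ) (hθ : θ ∈ F.Θ) : 0 ≤ F.bregman t θ := by
  have hd := (F.analyticOnNhd_b t ht).differentiableAt
  rcases lt_trichotomy t θ with h | h | h
  · have := F.convexOn_b.deriv_le_slope ht hθ h hd
    rw [slope_def_field, le_div_iff₀ (by linarith)] at this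
    unfold bregman; linarith
  · subst h; simp [bregman]
  · have := F.convexOn_b.slope_le_deriv hθ ht h hd
    rw [slope_def_field, div_le_iff₀ (by linarith)] at this
    unfold bregman; linarith

theorem continuousOn_bregman {t : ℝ} : ContinuousOn (F.bregman t) F.Θ := by
  unfold bregman
  have := F.analyticOnNhd_b.continuousOn
  fun_prop

/-- The likelihood is its maximum times the exponential of minus `n` times the divergence from the
estimate. -/
theorem likelihood_eq {n : ℕ} (y : Fin n → ℝ) (hn : n ≠ 0)
    (hy : sampleMean y ∈ deriv F.b '' F.Θ) (θ : ℝ) :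
    F.likelihood y θ = F.likelihood y (F.canonicalEstimate (sampleMean y)) *
      Real.exp (-(n * F.bregman (F.canonicalEstimate (sampleMean y)) θ)) := by
  have key : ∀ θ, F.likelihood y θ =
      (∏ i, F.q (y i)) * Real.exp (n * (sampleMean y * θ - F.b θ)) := by
    intro θ
    have hs : (n : ℝ) * (sampleMean y * θ - F.b θ) = ∑ i, (y i * θ - F.b θ) := by
      rw [Finset.sum_sub_distrib, ← Finset.sum_mul, sampleMean]
      have : (n : ℝ) ≠ 0 := by exact_mod_cast hn
      simp only [Finset.sum_const, Finset.card_univ, Fintype.card_fin, nsmul_eq_mul]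
      field_simp
    rw [hs, Real.exp_sum, ← Finset.prod_mul_distrib]
    rfl
  rw [key, key (F.canonicalEstimate _), mul_assoc, ← Real.exp_add, bregman,
    F.deriv_b_canonicalEstimate hy]
  ring_nf

theorem likelihood_pos {n : ℕ} {y : Fin n → ℝ} (hy : ∀ i, 0 < F.q (y i)) (θ : ℝ) :
    0 < F.likelihood y θ :=
  Finset.prod_pos fun i _ => mul_pos (hy i) (Real.exp_pos _)

/-! ### Bounds on the divergence, uniform over nearby base points -/

variable {F}

theorem exists_ball_bregman_le {t u : ℝ} (ht : t ∈ F.Θ) (hu : u ∈ F.Θ) {K : ℝ}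
    (hK : F.bregman t u < K) :
    ∃ ρ > 0, ∀ s ∈ Metric.ball t ρ, ∀ θ ∈ Metric.ball u ρ, F.bregman s θ ≤ K := by
  have hbt : ContinuousAt F.b t := (F.analyticOnNhd_b t ht).continuousAt
  have hbu : ContinuousAt F.b u := (F.analyticOnNhd_b u hu).continuousAt
  have hb' : ContinuousAt (deriv F.b) t := (F.analyticOnNhd_b t ht).deriv.continuousAt
  have hc : Tendsto (fun p : ℝ × ℝ => F.bregman p.1 p.2) (𝓝 (t, u)) (𝓝 (F.bregman t u)) := by
    rw [nhds_prod_eq]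
    have h1 : Tendsto (fun p : ℝ × ℝ => p.1) (𝓝 t ×ˢ 𝓝 u) (𝓝 t) := tendsto_fst
    have h2 : Tendsto (fun p : ℝ × ℝ => p.2) (𝓝 t ×ˢ 𝓝 u) (𝓝 u) := tendsto_snd
    exact ((hbu.tendsto.comp h2).sub (hbt.tendsto.comp h1)).sub
      ((hb'.tendsto.comp h1).mul (h2.sub h1))
  obtain ⟨ρ, hρ, hsub⟩ := Metric.mem_nhds_iff.1 (hc.eventually_le_const hK)
  refine ⟨ρ, hρ, fun s hs θ hθ => ?_⟩
  have hm : (s, θ) ∈ Metric.ball (t, u) ρ := by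
    rw [← ball_prod_same]
    exact ⟨hs, hθ⟩
  exact hsub hm

/-- Changing the base point from s to u costs only an affine function of θ. With u an anchor between
s and θ, all three terms are nonnegative, and the last grows linearly in θ. -/
theorem bregman_three_point (s u θ : ℝ) :
    F.bregman s θ = F.bregman u θ + F.bregman s u + (deriv F.b u - deriv F.b s) * (θ - u) := by
  unfold bregman; ring

/-- Away from `t` the divergence from points near `t` is bounded below. -/
theorem exists_le_bregman (hB : StrictMonoOn (deriv F.b) F.Θ) {t : ℝ} (ht : t ∈ F.Θ) {ρ : ℝ}
    (hρ : 0 < ρ) : ∃ c > 0, ∃ σ > 0, ∀ s ∈ Metric.ball t σ, ∀ θ ∈ F.Θ, ρ ≤ |θ - t| →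
      c ≤ F.bregman s θ := by
  obtain ⟨τ, hτ, hsub⟩ := Metric.isOpen_iff.1 F.isOpen_Θ t ht
  -- The anchors t ± 2σ must lie in Θ, be separated from every s within σ of t, and leave a gap of
  -- at least σ to θ, whence the factor 4.
  obtain ⟨σ, hσ, hσρ, hστ⟩ : ∃ σ > 0, 4 * σ ≤ ρ ∧ 4 * σ ≤ τ :=
    ⟨min ρ τ / 4, by positivity, by linarith [min_le_left ρ τ], by linarith [min_le_right ρ τ]⟩
  have hmem : ∀ x, |x - t| < 4 * σ → x ∈ F.Θ := fun x hx =>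
    hsub (by rw [Metric.mem_ball, Real.dist_eq]; linarith)
  have m1 : t - 2 * σ ∈ F.Θ := hmem _ (by rw [abs_lt]; constructor <;> linarith)
  have m2 : t - σ ∈ F.Θ := hmem _ (by rw [abs_lt]; constructor <;> linarith)
  have m3 : t + σ ∈ F.Θ := hmem _ (by rw [abs_lt]; constructor <;> linarith)
  have m4 : t + 2 * σ ∈ F.Θ := hmem _ (by rw [abs_lt]; constructor <;> linarith)
  have h1 := hB m1 m2 (by linarith)
  have h2 := hB m3 m4 (by linarith)
  refine ⟨min ((deriv F.b (t - σ) - deriv F.b (t - 2 * σ)) * σ)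
    ((deriv F.b (t + 2 * σ) - deriv F.b (t + σ)) * σ),
    lt_min (mul_pos (by linarith) hσ) (mul_pos (by linarith) hσ), σ, hσ, ?_⟩
  intro s hs θ hθ hd
  rw [Metric.mem_ball, Real.dist_eq, abs_lt] at hs
  have ms : s ∈ F.Θ := hmem s (by rw [abs_lt]; constructor <;> linarith)
  rcases le_abs.1 hd with h | h
  · refine (min_le_right _ _).trans ?_
    rw [bregman_three_point s (t + 2 * σ) θ]
    have hm := F.monotoneOn_deriv_b ms m3 (by linarith)
    have := mul_le_mul (show deriv F.b (t + 2 * σ) - deriv F.b (t + σ) ≤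
      deriv F.b (t + 2 * σ) - deriv F.b s by linarith) (show σ ≤ θ - (t + 2 * σ) by linarith)
      hσ.le (by linarith)
    linarith [F.bregman_nonneg m4 hθ, F.bregman_nonneg ms m4]
  · refine (min_le_left _ _).trans ?_
    rw [bregman_three_point s (t - 2 * σ) θ]
    have hm := F.monotoneOn_deriv_b m2 ms (by linarith)
    have := mul_le_mul (show deriv F.b (t - σ) - deriv F.b (t - 2 * σ) ≤
      deriv F.b s - deriv F.b (t - 2 * σ) by linarith) (show σ ≤ (t - 2 * σ) - θ by linarith)
      hσ.le (by linarith)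
    linarith [F.bregman_nonneg m1 hθ, F.bregman_nonneg ms m1]

/-- The divergences from points near `t` dominate, up to constants, the divergence from any fixed
point. -/
theorem exists_mul_bregman_sub_le (hB : StrictMonoOn (deriv F.b) F.Θ) {t u : ℝ} (ht : t ∈ F.Θ)
    (hu : u ∈ F.Θ) :
    ∃ c > 0, ∃ C, ∃ σ > 0, ∀ s ∈ Metric.ball t σ, ∀ θ ∈ F.Θ,
      c * F.bregman u θ - C ≤ F.bregman s θ := by
  obtain ⟨τ, hτ, hsub⟩ := Metric.isOpen_iff.1 F.isOpen_Θ t ht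
  obtain ⟨σ, hσ, hστ⟩ : ∃ σ > 0, 4 * σ ≤ τ := ⟨τ / 4, by positivity, by linarith⟩
  have hmem : ∀ x, |x - t| < 4 * σ → x ∈ F.Θ := fun x hx =>
    hsub (by rw [Metric.mem_ball, Real.dist_eq]; linarith)
  have m1 : t - 2 * σ ∈ F.Θ := hmem _ (by rw [abs_lt]; constructor <;> linarith)
  have m2 : t - σ ∈ F.Θ := hmem _ (by rw [abs_lt]; constructor <;> linarith)
  have m3 : t + σ ∈ F.Θ := hmem _ (by rw [abs_lt]; constructor <;> linarith)
  have m4 : t + 2 * σ ∈ F.Θ := hmem _ (by rw [abs_lt]; constructor <;> linarith)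
  have h1 := hB m1 m2 (by linarith)
  have h2 := hB m3 m4 (by linarith)
  set p := t - 2 * σ with hp
  set q := t + 2 * σ with hq
  set g₁ := deriv F.b (t - σ) - deriv F.b p with hg₁
  set g₂ := deriv F.b q - deriv F.b (t + σ) with hg₂
  have hg₁0 : 0 < g₁ := by linarith
  have hg₂0 : 0 < g₂ := by linarith
  set k₁ := |deriv F.b u - deriv F.b p| with hk₁
  set k₂ := |deriv F.b q - deriv F.b u| with hk₂
  have hk₁0 : 0 ≤ k₁ := abs_nonneg _
  have hk₂0 : 0 ≤ k₂ := abs_nonneg _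
  -- Beyond the anchors p and q both divergences satisfy the three-point identity; c ≤ 1 handles the
  -- common divergence from the anchor, and c kᵢ ≤ gᵢ makes the linear term of u subordinate to that
  -- of s. The `+ 1` avoids division by zero.
  obtain ⟨c, hc, hc1, hc₁, hc₂⟩ : ∃ c > 0, c ≤ 1 ∧ c * k₁ ≤ g₁ ∧ c * k₂ ≤ g₂ := by
    refine ⟨min 1 (min (g₁ / (k₁ + 1)) (g₂ / (k₂ + 1))), by positivity, min_le_left _ _, ?_, ?_⟩
    · have h : min 1 (min (g₁ / (k₁ + 1)) (g₂ / (k₂ + 1))) ≤ g₁ / (k₁ + 1) :=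
        (min_le_right _ _).trans (min_le_left _ _)
      have h0 : 0 < min 1 (min (g₁ / (k₁ + 1)) (g₂ / (k₂ + 1))) := by positivity
      rw [le_div_iff₀ (by positivity)] at h
      linarith
    · have h : min 1 (min (g₁ / (k₁ + 1)) (g₂ / (k₂ + 1))) ≤ g₂ / (k₂ + 1) :=
        (min_le_right _ _).trans (min_le_right _ _)
      have h0 : 0 < min 1 (min (g₁ / (k₁ + 1)) (g₂ / (k₂ + 1))) := by positivity
      rw [le_div_iff₀ (by positivity)] at h
      linarith
  -- Between the anchors the divergence from u is bounded by compactness, which the constant C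
  -- absorbs.
  have hIcc : Set.Icc p q ⊆ F.Θ := F.ordConnected_Θ.out m1 m4
  obtain ⟨K, hK⟩ := isCompact_Icc.exists_bound_of_continuousOn
    ((F.continuousOn_bregman (t := u)).mono hIcc)
  have hup := F.bregman_nonneg hu m1
  have huq := F.bregman_nonneg hu m4
  refine ⟨c, hc, F.bregman u p + F.bregman u q + |K|, σ, hσ, fun s hs θ hθ => ?_⟩
  rw [Metric.mem_ball, Real.dist_eq, abs_lt] at hs
  have ms : s ∈ F.Θ := hmem s (by rw [abs_lt]; constructor <;> linarith)
  have hs₁ : g₁ ≤ deriv F.b s - deriv F.b p := by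
    linarith [F.monotoneOn_deriv_b m2 ms (by linarith)]
  have hs₂ : g₂ ≤ deriv F.b q - deriv F.b s := by
    linarith [F.monotoneOn_deriv_b ms m3 (by linarith)]
  have hscale : ∀ x, 0 ≤ x → c * x ≤ x := fun x hx => mul_le_of_le_one_left hx hc1
  rcases lt_or_ge θ p with h | h
  · have e1 := bregman_three_point (F := F) s p θ
    have e2 := bregman_three_point (F := F) u p θ
    have h3 : c * ((deriv F.b p - deriv F.b u) * (θ - p)) ≤ g₁ * (p - θ) := by
      have : c * (deriv F.b u - deriv F.b p) ≤ g₁ :=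
        (mul_le_mul_of_nonneg_left (le_abs_self _) hc.le).trans hc₁
      have := mul_le_mul_of_nonneg_right this (show 0 ≤ p - θ by linarith)
      linarith
    have h4 := mul_le_mul_of_nonneg_right hs₁ (show 0 ≤ p - θ by linarith)
    rw [e2, mul_add, mul_add]
    linarith [hscale _ (F.bregman_nonneg m1 hθ), hscale _ hup, F.bregman_nonneg ms m1,
      abs_nonneg K]
  rcases lt_or_ge q θ with h' | h'
  · have e1 := bregman_three_point (F := F) s q θ
    have e2 := bregman_three_point (F := F) u q θ
    have h3 : c * ((deriv F.b q - deriv F.b u) * (θ - q)) ≤ g₂ * (θ - q) := by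
      have : c * (deriv F.b q - deriv F.b u) ≤ g₂ :=
        (mul_le_mul_of_nonneg_left (le_abs_self _) hc.le).trans hc₂
      have := mul_le_mul_of_nonneg_right this (show 0 ≤ θ - q by linarith)
      linarith
    have h4 := mul_le_mul_of_nonneg_right hs₂ (show 0 ≤ θ - q by linarith)
    rw [e2, mul_add, mul_add]
    linarith [hscale _ (F.bregman_nonneg m4 hθ), hscale _ huq, F.bregman_nonneg ms m4,
      abs_nonneg K]
  · have h5 := (Real.norm_eq_abs _ ▸ hK θ ⟨h, h'⟩ : |F.bregman u θ| ≤ K)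
    linarith [hscale _ (F.bregman_nonneg hu hθ), le_abs_self (F.bregman u θ), le_abs_self K,
      F.bregman_nonneg ms hθ]

end ExpFamily

/-! ### Laplace-type bounds for Gibbs means -/

section Laplace

variable {X : Type*} [MeasurableSpace X] {μ : Measure X} {E H : X → ℝ} {N a : ℝ}

theorem measureReal_mul_exp_le_integral {φ : X → ℝ}
    (hint : Integrable (fun x => Real.exp (-φ x)) μ) {V : Set X} (hV : MeasurableSet V)
    (hVfin : μ V ≠ ⊤) {K : ℝ} (hφ : ∀ᵐ x ∂μ, x ∈ V → φ x ≤ K) :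
    μ.real V * Real.exp (-K) ≤ ∫ x, Real.exp (-φ x) ∂μ := by
  calc μ.real V * Real.exp (-K) = ∫ _ in V, Real.exp (-K) ∂μ := by simp
    _ ≤ ∫ x in V, Real.exp (-φ x) ∂μ := by
      refine setIntegral_mono_on_ae (integrableOn_const hVfin) hint.integrableOn hV ?_
      filter_upwards [hφ] with x hx hxV
      exact Real.exp_le_exp.2 (neg_le_neg (hx hxV))
    _ ≤ _ := setIntegral_le_integral hint (ae_of_all _ fun _ => Real.exp_nonneg _)

variable (μ E H) in
/-- The mean of `exp (-N E)` under the probability density proportional to `exp (-N a H)`. -/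
def gibbsMean (N a : ℝ) : ℝ :=
  (∫ x, Real.exp (-(N * (E x + a * H x))) ∂μ) / ∫ x, Real.exp (-(N * (a * H x))) ∂μ

theorem gibbsMean_nonneg : 0 ≤ gibbsMean μ E H N a :=
  div_nonneg (integral_nonneg fun _ => Real.exp_nonneg _)
    (integral_nonneg fun _ => Real.exp_nonneg _)

theorem integrable_exp_neg_mul_add (hEm : Measurable E) (hHm : Measurable H) (hN : 0 ≤ N)
    (hE : ∀ᵐ x ∂μ, 0 ≤ E x) (hint : Integrable (fun x => Real.exp (-(N * (a * H x)))) μ) :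
    Integrable (fun x => Real.exp (-(N * (E x + a * H x)))) μ := by
  refine hint.mono' (by fun_prop) ?_
  filter_upwards [hE] with x hx
  rw [Real.norm_eq_abs, Real.abs_exp, Real.exp_le_exp]
  nlinarith [mul_nonneg hN hx]

theorem gibbsMean_le_one (hEm : Measurable E) (hHm : Measurable H) (hN : 0 ≤ N)
    (hE : ∀ᵐ x ∂μ, 0 ≤ E x) (hint : Integrable (fun x => Real.exp (-(N * (a * H x)))) μ) :
    gibbsMean μ E H N a ≤ 1 := by
  refine div_le_one_of_le₀ (integral_mono_ae (integrable_exp_neg_mul_add hEm hHm hN hE hint)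
    hint ?_) (integral_nonneg fun _ => Real.exp_nonneg _)
  filter_upwards [hE] with x hx
  rw [Real.exp_le_exp]
  nlinarith [mul_nonneg hN hx]

/-- Off V the factor exp(-N E) is at most exp(-N c), and the remaining integrand is that of the
denominator. On V the numerator is at most exp(-N ε c), while the denominator is at least its part
on W, where a H ≤ H ≤ κ. -/
theorem gibbsMean_le (hEm : Measurable E) (hHm : Measurable H) (hN : 0 ≤ N)
    (hE : ∀ᵐ x ∂μ, 0 ≤ E x) (hH : ∀ᵐ x ∂μ, 0 ≤ H x)
    (hint : Integrable (fun x => Real.exp (-(N * (a * H x)))) μ)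
    {V W : Set X} (hV : MeasurableSet V) (hVfin : μ V ≠ ⊤)
    (hW : MeasurableSet W) (hW0 : μ W ≠ 0) (hWfin : μ W ≠ ⊤) {ε c κ : ℝ} (hc : 0 ≤ c)
    (hV' : ∀ᵐ x ∂μ, (x ∉ V → c ≤ E x) ∧ (x ∈ V → c ≤ H x))
    (hW' : ∀ᵐ x ∂μ, x ∈ W → H x ≤ κ) (hε : 0 ≤ ε) (hεa : ε ≤ a) (ha : a ≤ 1) :
    gibbsMean μ E H N a ≤
      Real.exp (-(N * c)) + μ.real V / μ.real W * Real.exp (-(N * (ε * c - κ))) := by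
  have hWpos : 0 < μ.real W := ENNReal.toReal_pos hW0 hWfin
  have ha0 : 0 ≤ a := hε.trans hεa
  have hden : μ.real W * Real.exp (-(N * κ)) ≤ ∫ x, Real.exp (-(N * (a * H x))) ∂μ := by
    refine measureReal_mul_exp_le_integral hint hW hWfin ?_
    filter_upwards [hW', hH] with x hx hx0 hxW
    exact mul_le_mul_of_nonneg_left ((mul_le_of_le_one_left hx0 ha).trans (hx hxW)) hN
  have hden0 : 0 < ∫ x, Real.exp (-(N * (a * H x))) ∂μ :=
    (mul_pos hWpos (Real.exp_pos _)).trans_le hden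
  have hindint : Integrable (V.indicator fun _ => Real.exp (-(N * (ε * c)))) μ :=
    (integrable_indicator_iff hV).2 (integrableOn_const hVfin)
  have hnum : ∫ x, Real.exp (-(N * (E x + a * H x))) ∂μ ≤
      Real.exp (-(N * c)) * (∫ x, Real.exp (-(N * (a * H x))) ∂μ) +
        μ.real V * Real.exp (-(N * (ε * c))) := by
    have : μ.real V * Real.exp (-(N * (ε * c))) =
        ∫ x, V.indicator (fun _ => Real.exp (-(N * (ε * c)))) x ∂μ := by
      rw [integral_indicator hV]; simp
    rw [this, ← integral_const_mul, ← integral_add (hint.const_mul _) hindint]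
    refine integral_mono_ae (integrable_exp_neg_mul_add hEm hHm hN hE hint)
      ((hint.const_mul _).add hindint) ?_
    filter_upwards [hE, hH, hV'] with x hxE hxH hx
    by_cases hxV : x ∈ V
    · simp only [Set.indicator_of_mem hxV]
      refine le_add_of_nonneg_of_le (by positivity) (Real.exp_le_exp.2 (neg_le_neg ?_))
      refine mul_le_mul_of_nonneg_left ?_ hN
      have := mul_le_mul hεa (hx.2 hxV) hc ha0
      linarith
    · simp only [Set.indicator_of_notMem hxV, add_zero]
      rw [← Real.exp_add, Real.exp_le_exp]
      have := mul_le_mul_of_nonneg_left (hx.1 hxV) hN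
      linarith
  rw [gibbsMean, div_le_iff₀ hden0]
  refine hnum.trans ?_
  rw [add_mul]
  refine add_le_add le_rfl ?_
  calc μ.real V * Real.exp (-(N * (ε * c)))
      = μ.real V / μ.real W * Real.exp (-(N * (ε * c - κ))) *
        (μ.real W * Real.exp (-(N * κ))) := by
        rw [show -(N * (ε * c)) = -(N * (ε * c - κ)) + -(N * κ) by ring, Real.exp_add]
        field_simp
    _ ≤ _ := mul_le_mul_of_nonneg_left hden (by positivity)

/-- V is meant to surround the minimum of E: H may be large there, but it enters only through a M,
which is small for small a. -/
theorem le_gibbsMean (hEm : Measurable E) (hHm : Measurable H) (hN : 0 ≤ N)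
    (hE : ∀ᵐ x ∂μ, 0 ≤ E x)
    (hint : Integrable (fun x => Real.exp (-(N * (a * H x)))) μ)
    {V : Set X} (hV : MeasurableSet V) (hV0 : μ V ≠ 0) (hVfin : μ V ≠ ⊤) {κ M C : ℝ}
    (hV' : ∀ᵐ x ∂μ, x ∈ V → E x ≤ κ ∧ H x ≤ M) (ha : 0 ≤ a)
    (hC : ∫ x, Real.exp (-(N * (a * H x))) ∂μ ≤ C) :
    μ.real V / C * Real.exp (-(N * (κ + a * M))) ≤ gibbsMean μ E H N a := by
  have hVpos : 0 < μ.real V := ENNReal.toReal_pos hV0 hVfin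
  have hnum : μ.real V * Real.exp (-(N * (κ + a * M))) ≤
      ∫ x, Real.exp (-(N * (E x + a * H x))) ∂μ := by
    refine measureReal_mul_exp_le_integral (integrable_exp_neg_mul_add hEm hHm hN hE hint)
      hV hVfin ?_
    filter_upwards [hV'] with x hx hxV
    have := mul_le_mul_of_nonneg_left (hx hxV).2 ha
    exact mul_le_mul_of_nonneg_left (by linarith [(hx hxV).1]) hN
  have hden0 : 0 < ∫ x, Real.exp (-(N * (a * H x))) ∂μ := by
    refine (mul_pos hVpos (Real.exp_pos (-(N * (a * M))))).trans_le
      (measureReal_mul_exp_le_integral hint hV hVfin ?_)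
    filter_upwards [hV'] with x hx hxV
    exact mul_le_mul_of_nonneg_left (mul_le_mul_of_nonneg_left (hx hxV).2 ha) hN
  rw [gibbsMean, div_mul_eq_mul_div]
  exact div_le_div₀ (integral_nonneg fun _ => Real.exp_nonneg _) hnum hden0 hC

theorem measurable_gibbsMean [SFinite μ] (hEm : Measurable E) (hHm : Measurable H) :
    Measurable (gibbsMean μ E H N) := by
  refine Measurable.div ?_ ?_
  · refine (StronglyMeasurable.integral_prod_right
      (f := fun a x => Real.exp (-(N * (E x + a * H x)))) ?_).measurable
    exact Measurable.stronglyMeasurable (by unfold Function.uncurry; fun_prop)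
  · refine (StronglyMeasurable.integral_prod_right
      (f := fun a x => Real.exp (-(N * (a * H x)))) ?_).measurable
    exact Measurable.stronglyMeasurable (by unfold Function.uncurry; fun_prop)

/-- If `R k ≤ K exp (-η N k) L k` with `L k > 0`, then `L / (L + R)` tends to one. -/
theorem tendsto_div_add_one {N L R : ℕ → ℝ} {K η : ℝ} (hη : 0 < η) (hN : Tendsto N atTop atTop)
    (hL : ∀ᶠ k in atTop, 0 < L k) (hR0 : ∀ᶠ k in atTop, 0 ≤ R k)
    (hR : ∀ᶠ k in atTop, R k ≤ K * Real.exp (-(N k * η)) * L k) :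
    Tendsto (fun k => L k / (L k + R k)) atTop (𝓝 1) := by
  have h0 : Tendsto (fun k => K * Real.exp (-(N k * η))) atTop (𝓝 0) := by
    have : Tendsto (fun k => Real.exp (-(N k * η))) atTop (𝓝 0) :=
      Real.tendsto_exp_neg_atTop_nhds_zero.comp (hN.atTop_mul_const hη)
    simpa using this.const_mul K
  refine tendsto_of_tendsto_of_tendsto_of_le_of_le'
    (by simpa using h0.const_sub 1) tendsto_const_nhds ?_ ?_
  · filter_upwards [hL, hR0, hR] with k h1 h2 h3
    rw [le_div_iff₀ (by linarith)]
    nlinarith [mul_nonneg h2 h2, mul_pos h1 h1,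
      show 0 ≤ K * Real.exp (-(N k * η)) by by_contra! h; nlinarith]
  · filter_upwards [hL, hR0] with k h1 h2
    exact div_le_one_of_le₀ (by linarith) (by linarith)

theorem integrable_gibbsMean_mul [SFinite μ] (hEm : Measurable E) (hHm : Measurable H)
    (hN : 0 ≤ N) (hE : ∀ᵐ x ∂μ, 0 ≤ E x)
    (hint : ∀ a ∈ Set.Ioo (0 : ℝ) 1, Integrable (fun x => Real.exp (-(N * (a * H x)))) μ)
    {f : ℝ → ℝ} (hf : Integrable f) (hf0 : ∀ a, 0 ≤ f a) (hfz : ∀ a ∉ Set.Ioo (0 : ℝ) 1, f a = 0) :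
    Integrable fun a => gibbsMean μ E H N a * f a := by
  refine hf.mono' ((measurable_gibbsMean hEm hHm).aestronglyMeasurable.mul
    hf.aestronglyMeasurable) (ae_of_all _ fun a => ?_)
  rw [Real.norm_eq_abs, abs_of_nonneg (mul_nonneg gibbsMean_nonneg (hf0 a))]
  by_cases ha : a ∈ Set.Ioo (0 : ℝ) 1
  · exact mul_le_of_le_one_left (hf0 a) (gibbsMean_le_one hEm hHm hN hE (hint a ha))
  · simp [hfz a ha]

variable {E H : ℕ → X → ℝ} {N : ℕ → ℝ} {f : ℝ → ℝ}

/-- If the minimum of `E` is separated from that of `H`, then the mass that the density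
proportional to `gibbsMean * f` puts on `[ε, 1]` is exponentially small compared with that on
`[0, ε]`. -/
theorem eventually_integral_gibbsMean_le [SFinite μ]
    (hEm : ∀ k, Measurable (E k)) (hHm : ∀ k, Measurable (H k)) (hN : ∀ k, 0 ≤ N k)
    (hNtop : Tendsto N atTop atTop)
    (hE : ∀ k, ∀ᵐ x ∂μ, 0 ≤ E k x) (hH : ∀ k, ∀ᵐ x ∂μ, 0 ≤ H k x)
    (hint : ∀ k, ∀ a ∈ Set.Ioo (0 : ℝ) 1,
      Integrable (fun x => Real.exp (-(N k * (a * H k x)))) μ)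
    (hsep : ∃ c > 0, ∃ V, MeasurableSet V ∧ μ V ≠ ⊤ ∧
      ∀ᶠ k in atTop, ∀ᵐ x ∂μ, (x ∉ V → c ≤ E k x) ∧ (x ∈ V → c ≤ H k x))
    (hEmin : ∀ κ > 0, ∃ M, ∃ V, MeasurableSet V ∧ μ V ≠ 0 ∧ μ V ≠ ⊤ ∧
      ∀ᶠ k in atTop, ∀ᵐ x ∂μ, x ∈ V → E k x ≤ κ ∧ H k x ≤ M)
    (hHmin : ∀ κ > 0, ∃ V, MeasurableSet V ∧ μ V ≠ 0 ∧ μ V ≠ ⊤ ∧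
      ∀ᶠ k in atTop, ∀ᵐ x ∂μ, x ∈ V → H k x ≤ κ)
    (htail : ∃ L, ∃ C > 0, ∀ᶠ k in atTop, Integrable (fun x => Real.exp (-(L * H k x))) μ ∧
      ∫ x, Real.exp (-(L * H k x)) ∂μ ≤ C)
    (hf : Integrable f) (hf0 : ∀ a, 0 ≤ f a) (hfpos : ∀ a ∈ Set.Ioo (0 : ℝ) 1, 0 < f a)
    (hfz : ∀ a ∉ Set.Ioo (0 : ℝ) 1, f a = 0) {ε : ℝ} (hε : 0 < ε) (hε1 : ε < 1) :
    ∃ K, ∃ η > 0, ∀ᶠ k in atTop,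
      0 < ∫ a in (0 : ℝ)..ε, gibbsMean μ (E k) (H k) (N k) a * f a ∧
      ∫ a in ε..1, gibbsMean μ (E k) (H k) (N k) a * f a ≤
        K * Real.exp (-(N k * η)) *
          ∫ a in (0 : ℝ)..ε, gibbsMean μ (E k) (H k) (N k) a * f a := by
  obtain ⟨c, hc, V, hV, hVfin, hVk⟩ := hsep
  -- Taking κ = η in the upper bound leaves the rate εc - η = η on [ε, 1]. The lower bound spends
  -- η/4 on E and η/4 on a H, so the rate η/2 remains.
  set η := ε * c / 2 with hη
  have hη0 : 0 < η := by positivity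
  obtain ⟨W, hW, hW0, hWfin, hWk⟩ := hHmin η hη0
  obtain ⟨M, U, hU, hU0, hUfin, hUk⟩ := hEmin (η / 4) (by positivity)
  obtain ⟨L, C, hC, hLk⟩ := htail
  have hUpos : 0 < μ.real U := ENNReal.toReal_pos hU0 hUfin
  have hWpos : 0 < μ.real W := ENNReal.toReal_pos hW0 hWfin
  obtain ⟨s, hs, hsε, hsM⟩ : ∃ s > 0, s ≤ ε ∧ s * |M| ≤ η / 4 := by
    refine ⟨min ε (η / 4 / (|M| + 1)), by positivity, min_le_left _ _, ?_⟩
    have h : min ε (η / 4 / (|M| + 1)) ≤ η / 4 / (|M| + 1) := min_le_right _ _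
    have h0 : 0 < min ε (η / 4 / (|M| + 1)) := by positivity
    rw [le_div_iff₀ (by positivity)] at h
    linarith
  have hA : 0 < ∫ a in s / 2..s, f a :=
    intervalIntegral.intervalIntegral_pos_of_pos_on hf.intervalIntegrable
      (fun a ha => hfpos a ⟨by linarith [ha.1], by linarith [ha.2]⟩) (by linarith)
  set A := ∫ a in s / 2..s, f a
  have hB : 0 ≤ ∫ a in ε..1, f a :=
    intervalIntegral.integral_nonneg hε1.le fun a _ => hf0 a
  set B := ∫ a in ε..1, f a
  have hlowpos : 0 < μ.real U / C * A := by positivity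
  refine ⟨(1 + μ.real V / μ.real W) * B / (μ.real U / C * A), η / 2, by positivity, ?_⟩
  -- Staying above s/2 rather than reaching 0 ensures N a ≥ L for large N, so the tail bound C
  -- controls the denominator.
  filter_upwards [hVk, hWk, hUk, hLk, hNtop.eventually_ge_atTop (L / (s / 2))]
    with k hVk hWk hUk hLk hNk
  have hg := integrable_gibbsMean_mul (hEm k) (hHm k) (hN k) (hE k) (hint k) hf hf0 hfz
  have hg0 : ∀ a, 0 ≤ gibbsMean μ (E k) (H k) (N k) a * f a :=
    fun a => mul_nonneg gibbsMean_nonneg (hf0 a)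
  rw [div_le_iff₀ (by positivity)] at hNk
  have hlow : μ.real U / C * A * Real.exp (-(N k * (η / 2))) ≤
      ∫ a in (0 : ℝ)..ε, gibbsMean μ (E k) (H k) (N k) a * f a := by
    calc μ.real U / C * A * Real.exp (-(N k * (η / 2)))
        = ∫ a in s / 2..s, μ.real U / C * Real.exp (-(N k * (η / 2))) * f a := by
          rw [intervalIntegral.integral_const_mul]; ring
      _ ≤ ∫ a in s / 2..s, gibbsMean μ (E k) (H k) (N k) a * f a := by
          refine intervalIntegral.integral_mono_on_of_le_Ioo (by linarith)
            (hf.intervalIntegrable.const_mul _) hg.intervalIntegrable fun a ha => ?_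
          refine mul_le_mul_of_nonneg_right ?_ (hf0 a)
          have ha0 : 0 < a := by linarith [ha.1]
          have ha1 : a < 1 := by linarith [ha.2]
          refine le_trans ?_ (le_gibbsMean (hEm k) (hHm k) (hN k) (hE k) (hint k a ⟨ha0, ha1⟩)
            hU hU0 hUfin hUk ha0.le (?_ : _ ≤ C))
          · refine mul_le_mul_of_nonneg_left (Real.exp_le_exp.2 (neg_le_neg ?_)) (by positivity)
            refine mul_le_mul_of_nonneg_left ?_ (hN k)
            have h1 : a * M ≤ a * |M| := mul_le_mul_of_nonneg_left (le_abs_self M) ha0.le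
            have h2 : a * |M| ≤ s * |M| := mul_le_mul_of_nonneg_right ha.2.le (abs_nonneg M)
            linarith
          · refine le_trans (integral_mono_ae (hint k a ⟨ha0, ha1⟩) hLk.1 ?_) hLk.2
            filter_upwards [hH k] with x hx
            rw [Real.exp_le_exp, neg_le_neg_iff, ← mul_assoc]
            refine mul_le_mul_of_nonneg_right (hNk.trans ?_) hx
            exact mul_le_mul_of_nonneg_left ha.1.le (hN k)
      _ ≤ _ := intervalIntegral.integral_mono_interval (by linarith) (by linarith) hsε
          (ae_of_all _ hg0) hg.intervalIntegrable
  refine ⟨(mul_pos hlowpos (Real.exp_pos _)).trans_le hlow, ?_⟩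
  calc ∫ a in ε..1, gibbsMean μ (E k) (H k) (N k) a * f a
      ≤ ∫ a in ε..1, (1 + μ.real V / μ.real W) * Real.exp (-(N k * η)) * f a := by
        refine intervalIntegral.integral_mono_on_of_le_Ioo hε1.le hg.intervalIntegrable
          (hf.intervalIntegrable.const_mul _) fun a ha => ?_
        refine mul_le_mul_of_nonneg_right ?_ (hf0 a)
        refine (gibbsMean_le (hEm k) (hHm k) (hN k) (hE k) (hH k)
          (hint k a ⟨hε.trans ha.1, ha.2⟩) hV hVfin hW hW0 hWfin hc.le hVk hWk hε.le ha.1.le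
          ha.2.le).trans ?_
        rw [add_mul, one_mul, show ε * c - η = η by rw [hη]; ring]
        refine add_le_add (Real.exp_le_exp.2 (neg_le_neg
          (mul_le_mul_of_nonneg_left ?_ (hN k)))) le_rfl
        nlinarith
    _ = (1 + μ.real V / μ.real W) * B / (μ.real U / C * A) * Real.exp (-(N k * (η / 2))) *
        (μ.real U / C * A * Real.exp (-(N k * (η / 2)))) := by
        rw [intervalIntegral.integral_const_mul,
          show -(N k * η) = -(N k * (η / 2)) + -(N k * (η / 2)) by ring, Real.exp_add]
        field_simp
        rfl
    _ ≤ _ := mul_le_mul_of_nonneg_left hlow (by positivity)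

theorem tendsto_integral_gibbsMean [SFinite μ]
    (hEm : ∀ k, Measurable (E k)) (hHm : ∀ k, Measurable (H k)) (hN : ∀ k, 0 ≤ N k)
    (hNtop : Tendsto N atTop atTop)
    (hE : ∀ k, ∀ᵐ x ∂μ, 0 ≤ E k x) (hH : ∀ k, ∀ᵐ x ∂μ, 0 ≤ H k x)
    (hint : ∀ k, ∀ a ∈ Set.Ioo (0 : ℝ) 1,
      Integrable (fun x => Real.exp (-(N k * (a * H k x)))) μ)
    (hsep : ∃ c > 0, ∃ V, MeasurableSet V ∧ μ V ≠ ⊤ ∧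
      ∀ᶠ k in atTop, ∀ᵐ x ∂μ, (x ∉ V → c ≤ E k x) ∧ (x ∈ V → c ≤ H k x))
    (hEmin : ∀ κ > 0, ∃ M, ∃ V, MeasurableSet V ∧ μ V ≠ 0 ∧ μ V ≠ ⊤ ∧
      ∀ᶠ k in atTop, ∀ᵐ x ∂μ, x ∈ V → E k x ≤ κ ∧ H k x ≤ M)
    (hHmin : ∀ κ > 0, ∃ V, MeasurableSet V ∧ μ V ≠ 0 ∧ μ V ≠ ⊤ ∧
      ∀ᶠ k in atTop, ∀ᵐ x ∂μ, x ∈ V → H k x ≤ κ)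
    (htail : ∃ L, ∃ C > 0, ∀ᶠ k in atTop, Integrable (fun x => Real.exp (-(L * H k x))) μ ∧
      ∫ x, Real.exp (-(L * H k x)) ∂μ ≤ C)
    (hf : Integrable f) (hf0 : ∀ a, 0 ≤ f a) (hfpos : ∀ a ∈ Set.Ioo (0 : ℝ) 1, 0 < f a)
    (hfz : ∀ a ∉ Set.Ioo (0 : ℝ) 1, f a = 0) {ε : ℝ} (hε : 0 < ε) :
    (∀ᶠ k in atTop, 0 < ∫ a in (0 : ℝ)..1, gibbsMean μ (E k) (H k) (N k) a * f a) ∧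
    Tendsto (fun k => (∫ a in (0 : ℝ)..ε, gibbsMean μ (E k) (H k) (N k) a * f a) /
      ∫ a in (0 : ℝ)..1, gibbsMean μ (E k) (H k) (N k) a * f a) atTop (𝓝 1) := by
  have key := fun {ε : ℝ} (hε : 0 < ε) (hε1 : ε < 1) => eventually_integral_gibbsMean_le hEm hHm
    hN hNtop hE hH hint hsep hEmin hHmin htail hf hf0 hfpos hfz hε hε1
  have hg := fun k => integrable_gibbsMean_mul (hEm k) (hHm k) (hN k) (hE k) (hint k) hf hf0 hfz
  have hg0 : ∀ k a, 0 ≤ gibbsMean μ (E k) (H k) (N k) a * f a :=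
    fun k a => mul_nonneg gibbsMean_nonneg (hf0 a)
  have hpos : ∀ᶠ k in atTop, 0 < ∫ a in (0 : ℝ)..1, gibbsMean μ (E k) (H k) (N k) a * f a := by
    obtain ⟨K, η, -, h⟩ := key (ε := 1 / 2) (by norm_num) (by norm_num)
    filter_upwards [h] with k hk
    exact hk.1.trans_le (intervalIntegral.integral_mono_interval le_rfl (by norm_num)
      (by norm_num) (ae_of_all _ (hg0 k)) (hg k).intervalIntegrable)
  refine ⟨hpos, ?_⟩
  rcases lt_or_ge ε 1 with hε1 | hε1
  · obtain ⟨K, η, hη, h⟩ := key hε hε1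
    have := tendsto_div_add_one (K := K) hη hNtop (h.mono fun k hk => hk.1)
      (Eventually.of_forall fun k =>
        intervalIntegral.integral_nonneg hε1.le fun a _ => hg0 k a) (h.mono fun k hk => hk.2)
    refine this.congr fun k => ?_
    rw [intervalIntegral.integral_add_adjacent_intervals (hg k).intervalIntegrable
      (hg k).intervalIntegrable]
  -- For ε ≥ 1 both integrals agree, because f vanishes outside (0, 1).
  · refine tendsto_const_nhds.congr' ?_
    filter_upwards [hpos] with k hk
    have hz : ∫ a in (1 : ℝ)..ε, gibbsMean μ (E k) (H k) (N k) a * f a = 0 := by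
      rw [intervalIntegral.integral_congr (g := fun _ => (0 : ℝ)),
        intervalIntegral.integral_zero]
      intro a ha
      rw [Set.uIcc_of_le hε1] at ha
      simp [hfz a fun h => absurd h.2 (not_lt.2 ha.1)]
    rw [← intervalIntegral.integral_add_adjacent_intervals (hg k).intervalIntegrable
      ((hg k).intervalIntegrable (a := 1)), hz, add_zero, div_self hk.ne']

end Laplace

/-! ### The marginal posterior as a Gibbs mean over the initial prior -/

namespace ExpFamily

variable {F : ExpFamily} {π₀ : ℝ → ℝ}

variable (F π₀) in
/-- The initial prior as a measure on `Θ`. -/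
def priorMeasure : Measure ℝ :=
  (volume.restrict F.Θ).withDensity fun θ => ENNReal.ofReal (π₀ θ)

instance : SigmaFinite (F.priorMeasure π₀) := by
  unfold priorMeasure; infer_instance

theorem ae_mem_Θ : ∀ᵐ θ ∂F.priorMeasure π₀, θ ∈ F.Θ :=
  (withDensity_absolutelyContinuous _ _).ae_le (ae_restrict_mem F.isOpen_Θ.measurableSet)

theorem integral_priorMeasure (hm : Measurable π₀) (h0 : ∀ θ ∈ F.Θ, 0 ≤ π₀ θ) (g : ℝ → ℝ) :
    ∫ θ, g θ ∂F.priorMeasure π₀ = ∫ θ in F.Θ, g θ * π₀ θ := by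
  rw [priorMeasure, integral_withDensity_eq_integral_toReal_smul hm.ennreal_ofReal
    (ae_of_all _ fun _ => ENNReal.ofReal_lt_top)]
  refine setIntegral_congr_fun F.isOpen_Θ.measurableSet fun θ hθ => ?_
  simp only [ENNReal.toReal_ofReal (h0 θ hθ), smul_eq_mul, mul_comm]

theorem integrable_priorMeasure (hm : Measurable π₀) (h0 : ∀ θ ∈ F.Θ, 0 ≤ π₀ θ) {g : ℝ → ℝ} :
    Integrable g (F.priorMeasure π₀) ↔ IntegrableOn (fun θ => g θ * π₀ θ) F.Θ := by
  rw [priorMeasure, integrable_withDensity_iff_integrable_smul' hm.ennreal_ofReal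
    (ae_of_all _ fun _ => ENNReal.ofReal_lt_top)]
  refine integrableOn_congr_fun (fun θ hθ => ?_) F.isOpen_Θ.measurableSet
  simp only [ENNReal.toReal_ofReal (h0 θ hθ), smul_eq_mul, mul_comm]

/-- Small balls around a point where the prior density is positive and continuous have positive
finite prior mass. -/
theorem exists_priorMeasure_ball {t : ℝ} (ht : t ∈ F.Θ) (hpos : 0 < π₀ t)
    (hcont : ContinuousAt π₀ t) :
    ∃ ρ₀ > 0, ∀ ρ, 0 < ρ → ρ ≤ ρ₀ →
      F.priorMeasure π₀ (Metric.ball t ρ) ≠ 0 ∧ F.priorMeasure π₀ (Metric.ball t ρ) ≠ ⊤ := by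
  have hev : ∀ᶠ θ in 𝓝 t, θ ∈ F.Θ ∧ π₀ t / 2 < π₀ θ ∧ π₀ θ < 2 * π₀ t :=
    (F.isOpen_Θ.eventually_mem ht).and ((hcont.eventually_const_lt (by linarith)).and
      (hcont.eventually_lt_const (by linarith)))
  obtain ⟨ρ₀, hρ₀, hsub⟩ := Metric.mem_nhds_iff.1 hev
  refine ⟨ρ₀, hρ₀, fun ρ hρ hle => ?_⟩
  have hball : Metric.ball t ρ ⊆ Metric.ball t ρ₀ := Metric.ball_subset_ball hle
  have heq : F.priorMeasure π₀ (Metric.ball t ρ) =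
      ∫⁻ θ in Metric.ball t ρ, ENNReal.ofReal (π₀ θ) := by
    rw [priorMeasure, withDensity_apply _ measurableSet_ball,
      Measure.restrict_restrict measurableSet_ball,
      Set.inter_eq_left.2 fun x hx => (hsub (hball hx)).1]
  have hvol : volume (Metric.ball t ρ) ≠ 0 := (Metric.measure_ball_pos _ _ hρ).ne'
  rw [heq]
  constructor
  · refine ne_of_gt (lt_of_lt_of_le ?_ (setLIntegral_mono' (f := fun _ => ENNReal.ofReal (π₀ t / 2))
      measurableSet_ball fun x hx => ENNReal.ofReal_le_ofReal (hsub (hball hx)).2.1.le))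
    rw [setLIntegral_const]
    exact ENNReal.mul_pos (ENNReal.ofReal_pos.2 (by linarith)).ne' hvol
  · refine ne_of_lt (lt_of_le_of_lt (setLIntegral_mono' (g := fun _ => ENNReal.ofReal (2 * π₀ t))
      measurableSet_ball fun x hx => ENNReal.ofReal_le_ofReal (hsub (hball hx)).2.2.le) ?_)
    rw [setLIntegral_const]
    exact ENNReal.mul_lt_top ENNReal.ofReal_lt_top measure_ball_lt_top

/-- Outside Θ the function `b` is arbitrary, so the divergence is cut off there; the prior measure
does not see the change. -/
theorem measurable_indicator_bregman (c t : ℝ) :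
    Measurable (F.Θ.indicator fun θ => c * F.bregman t θ) := by
  classical
  rw [← Set.piecewise_eq_indicator]
  exact (continuousOn_const.mul F.continuousOn_bregman).measurable_piecewise continuousOn_const
    F.isOpen_Θ.measurableSet

theorem likelihood_rpow {n : ℕ} {y : Fin n → ℝ} (hn : n ≠ 0) (hq : ∀ i, 0 < F.q (y i))
    (hy : sampleMean y ∈ deriv F.b '' F.Θ) (a θ : ℝ) :
    F.likelihood y θ ^ a = F.likelihood y (F.canonicalEstimate (sampleMean y)) ^ a *
      Real.exp (-(n * a * F.bregman (F.canonicalEstimate (sampleMean y)) θ)) := by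
  rw [F.likelihood_eq y hn hy, Real.mul_rpow (F.likelihood_pos hq _).le (Real.exp_nonneg _),
    ← Real.exp_mul]
  ring_nf

theorem integrable_exp_bregman (hm : Measurable π₀) (h0 : ∀ θ ∈ F.Θ, 0 ≤ π₀ θ)
    {n : ℕ} {y : Fin n → ℝ} (hn : n ≠ 0) (hq : ∀ i, 0 < F.q (y i))
    (hy : sampleMean y ∈ deriv F.b '' F.Θ) {a : ℝ}
    (hc : IntegrableOn (fun θ => F.likelihood y θ ^ a * π₀ θ) F.Θ) :
    Integrable (fun θ => Real.exp (-(n * a * F.bregman (F.canonicalEstimate (sampleMean y)) θ)))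
      (F.priorMeasure π₀) := by
  have hA := Real.rpow_pos_of_pos (F.likelihood_pos hq (F.canonicalEstimate (sampleMean y))) a
  rw [← integrable_priorMeasure hm h0] at hc
  refine (hc.const_mul (F.likelihood y (F.canonicalEstimate (sampleMean y)) ^ a)⁻¹).congr
    (ae_of_all _ fun θ => ?_)
  simp only
  rw [likelihood_rpow hn hq hy a θ, inv_mul_cancel_left₀ hA.ne']

/-- The unnormalized marginal posterior of the discounting parameter as a Gibbs mean. -/
theorem marginalKernel_eq (hm : Measurable π₀) (h0 : ∀ θ ∈ F.Θ, 0 ≤ π₀ θ) {α₀ β₀ r : ℝ}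
    {n n₀ : ℕ} {y : Fin n → ℝ} {y₀ : Fin n₀ → ℝ} (hn : n ≠ 0) (hn₀ : n₀ ≠ 0)
    (hr : (n₀ : ℝ) = n * r) (hq₀ : ∀ i, 0 < F.q (y₀ i))
    (hy : sampleMean y ∈ deriv F.b '' F.Θ) (hy₀ : sampleMean y₀ ∈ deriv F.b '' F.Θ) (a : ℝ) :
    F.marginalKernel π₀ α₀ β₀ y y₀ a =
      F.likelihood y (F.canonicalEstimate (sampleMean y)) *
        (gibbsMean (F.priorMeasure π₀)
          (F.Θ.indicator fun θ => 1 * F.bregman (F.canonicalEstimate (sampleMean y)) θ)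
          (F.Θ.indicator fun θ => r * F.bregman (F.canonicalEstimate (sampleMean y₀)) θ) n a *
        ProbabilityTheory.betaPDFReal α₀ β₀ a) := by
  set t := F.canonicalEstimate (sampleMean y)
  set t₀ := F.canonicalEstimate (sampleMean y₀)
  have hA := Real.rpow_pos_of_pos (F.likelihood_pos hq₀ t₀) a
  have hL : ∀ θ, F.likelihood y θ = F.likelihood y t * Real.exp (-(n * F.bregman t θ)) :=
    F.likelihood_eq y hn hy
  have hL₀ : ∀ θ, F.likelihood y₀ θ ^ a =
      F.likelihood y₀ t₀ ^ a * Real.exp (-(n₀ * a * F.bregman t₀ θ)) :=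
    likelihood_rpow hn₀ hq₀ hy₀ a
  have hden : F.normConst π₀ y₀ a = F.likelihood y₀ t₀ ^ a * ∫ θ, Real.exp (-(n * (a *
      F.Θ.indicator (fun θ => r * F.bregman t₀ θ) θ))) ∂F.priorMeasure π₀ := by
    rw [normConst, ← integral_priorMeasure hm h0 (fun θ => F.likelihood y₀ θ ^ a),
      ← integral_const_mul]
    refine integral_congr_ae ?_
    filter_upwards [ae_mem_Θ] with θ hθ
    rw [hL₀, Set.indicator_of_mem hθ, hr]
    ring_nf
  have hnum : F.marginalKernel π₀ α₀ β₀ y y₀ a = F.likelihood y t * F.likelihood y₀ t₀ ^ a *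
      (∫ θ, Real.exp (-(n * (F.Θ.indicator (fun θ => 1 * F.bregman t θ) θ + a *
        F.Θ.indicator (fun θ => r * F.bregman t₀ θ) θ))) ∂F.priorMeasure π₀) /
        F.normConst π₀ y₀ a * ProbabilityTheory.betaPDFReal α₀ β₀ a := by
    have : F.marginalKernel π₀ α₀ β₀ y y₀ a = ∫ θ in F.Θ, (F.likelihood y θ *
        F.likelihood y₀ θ ^ a * (F.normConst π₀ y₀ a)⁻¹ *
          ProbabilityTheory.betaPDFReal α₀ β₀ a) * π₀ θ := by
      rw [marginalKernel]
      congr 1 with θ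
      rw [normalizedPowerPrior]
      ring
    rw [this, ← integral_priorMeasure hm h0 (fun θ => F.likelihood y θ *
        F.likelihood y₀ θ ^ a * (F.normConst π₀ y₀ a)⁻¹ *
          ProbabilityTheory.betaPDFReal α₀ β₀ a), integral_mul_const, integral_mul_const,
      ← integral_const_mul, div_eq_mul_inv]
    congr 2
    refine integral_congr_ae ?_
    filter_upwards [ae_mem_Θ] with θ hθ
    rw [hL₀, hL, Set.indicator_of_mem hθ, Set.indicator_of_mem hθ, mul_mul_mul_comm, ← Real.exp_add, hr]
    ring_nf
  -- The power of the maximal historical likelihood, the only factor that could favour some a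
  -- through scale alone, cancels here.
  rw [hnum, hden, gibbsMean, mul_assoc (F.likelihood y t), mul_left_comm,
    mul_div_mul_left _ _ hA.ne']
  ring

end ExpFamily

theorem integrable_betaPDFReal {α β : ℝ} (hα : 0 < α) (hβ : 0 < β) :
    Integrable (ProbabilityTheory.betaPDFReal α β) := by
  have h0 : ∀ x, 0 ≤ ProbabilityTheory.betaPDFReal α β x := fun x => by
    by_cases hx : 0 < x ∧ x < 1
    · exact (ProbabilityTheory.betaPDFReal_pos hx.1 hx.2 hα hβ).le
    · simp [ProbabilityTheory.betaPDFReal, hx]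
  refine ⟨(ProbabilityTheory.measurable_betaPDFReal α β).aestronglyMeasurable, ?_⟩
  rw [hasFiniteIntegral_iff_ofReal (ae_of_all _ h0)]
  exact (ProbabilityTheory.lintegral_betaPDF_eq_one hα hβ).trans_lt ENNReal.one_lt_top

end NPP
end

/-! ### Convergence of the discounting parameter to zero -/

open NPP NPP.ExpFamily in
theorem theorem2p1 (F : NPP.ExpFamily)
    -- the initial prior density (possibly improper) and the shape parameters of the beta prior
    (π₀ : ℝ → ℝ) (hπ₀_meas : Measurable π₀) (hπ₀_nonneg : ∀ θ ∈ F.Θ, 0 ≤ π₀ θ)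
    (α₀ β₀ : ℝ) (hα₀ : 0 < α₀) (hβ₀ : 0 < β₀)
    -- sample sizes growing to infinity with a fixed ratio
    (r : ℝ) (hr : 0 < r) (n n₀ : ℕ → ℕ) (hn : Tendsto n atTop atTop)
    (hratio : ∀ k, (n₀ k : ℝ) / (n k : ℝ) = r)
    -- current and historical data
    (y : (k : ℕ) → Fin (n k) → ℝ) (y₀ : (k : ℕ) → Fin (n₀ k) → ℝ)
    (hy : ∀ k i, 0 < F.q (y k i)) (hy₀ : ∀ k i, 0 < F.q (y₀ k i))
    -- the normalized power prior is well defined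
    (hc : ∀ k, ∀ a₀ ∈ Set.Ioc (0 : ℝ) 1,
      IntegrableOn (fun θ => F.likelihood (y₀ k) θ ^ a₀ * π₀ θ) F.Θ)
    -- the estimates of the canonical parameter exist and differ by the fixed amount `δ`
    (hmean : ∀ k, NPP.sampleMean (y k) ∈ deriv F.b '' F.Θ)
    (hmean₀ : ∀ k, NPP.sampleMean (y₀ k) ∈ deriv F.b '' F.Θ)
    (δ : ℝ) (hδ : 0 < δ)
    (hdiff : ∀ k, |F.canonicalEstimate (NPP.sampleMean (y k)) -
      F.canonicalEstimate (NPP.sampleMean (y₀ k))| = δ)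
    -- the estimates converge in `Θ`, and `π₀` is positive and continuous at the limits
    (θlim θ₀lim : ℝ) (hθlim : θlim ∈ F.Θ) (hθ₀lim : θ₀lim ∈ F.Θ)
    (hconv : Tendsto (fun k => F.canonicalEstimate (NPP.sampleMean (y k))) atTop (𝓝 θlim))
    (hconv₀ : Tendsto (fun k => F.canonicalEstimate (NPP.sampleMean (y₀ k))) atTop (𝓝 θ₀lim))
    (hpos : 0 < π₀ θlim) (hpos₀ : 0 < π₀ θ₀lim)
    (hcont : ContinuousAt π₀ θlim) (hcont₀ : ContinuousAt π₀ θ₀lim) :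
    ∀ ε : ℝ, 0 < ε →
      Tendsto (fun k =>
          (∫ a in (0 : ℝ)..ε, F.marginalPosterior π₀ α₀ β₀ (y k) (y₀ k) a) /
            ∫ a in (0 : ℝ)..1, F.marginalPosterior π₀ α₀ β₀ (y k) (y₀ k) a)
        atTop (𝓝 1) := by
  intro ε hε
  -- A zero sample size would make the ratio 0 by the convention x / 0 = 0, against r > 0.
  have hn0 : ∀ k, n k ≠ 0 := by
    intro k h
    have := hratio k
    rw [h] at this
    simp at this
    linarith
  have hnr : ∀ k, (n₀ k : ℝ) = n k * r := fun k => by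
    rw [← hratio k]
    have : (n k : ℝ) ≠ 0 := by exact_mod_cast hn0 k
    field_simp
  have hn₀0 : ∀ k, n₀ k ≠ 0 := by
    intro k h
    have := hnr k
    rw [h, Nat.cast_zero, eq_comm, mul_eq_zero] at this
    exact this.elim (by exact_mod_cast hn0 k) hr.ne'
  set t : ℕ → ℝ := fun k => F.canonicalEstimate (NPP.sampleMean (y k)) with ht
  set t₀ : ℕ → ℝ := fun k => F.canonicalEstimate (NPP.sampleMean (y₀ k)) with ht₀
  have htΘ : ∀ k, t k ∈ F.Θ := fun k => F.canonicalEstimate_mem (hmean k)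
  have ht₀Θ : ∀ k, t₀ k ∈ F.Θ := fun k => F.canonicalEstimate_mem (hmean₀ k)
  -- The estimates of the sample with index 0 are distinct, so their means are distinct values of
  -- the derivative of `b`.
  have hB : StrictMonoOn (deriv F.b) F.Θ := by
    refine F.strictMonoOn_deriv_b (htΘ 0) (ht₀Θ 0) fun h => ?_
    rw [F.deriv_b_canonicalEstimate (hmean 0), F.deriv_b_canonicalEstimate (hmean₀ 0)] at h
    have := hdiff 0
    rw [h, sub_self, abs_zero] at this
    exact hδ.ne this
  have hlim : |θlim - θ₀lim| = δ :=
    tendsto_nhds_unique ((hconv.sub hconv₀).abs) 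
      (tendsto_const_nhds.congr fun k => (hdiff k).symm)
  have hnear : ∀ ρ > 0, ∀ᶠ k in atTop, t k ∈ Metric.ball θlim ρ := fun ρ hρ =>
    hconv.eventually (Metric.ball_mem_nhds _ hρ)
  have hnear₀ : ∀ ρ > 0, ∀ᶠ k in atTop, t₀ k ∈ Metric.ball θ₀lim ρ := fun ρ hρ =>
    hconv₀.eventually (Metric.ball_mem_nhds _ hρ)
  obtain ⟨ρ₁, hρ₁, hball⟩ := exists_priorMeasure_ball hθlim hpos hcont
  obtain ⟨ρ₂, hρ₂, hball₀⟩ := exists_priorMeasure_ball hθ₀lim hpos₀ hcont₀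
  set μ := F.priorMeasure π₀ with hμ
  set E : ℕ → ℝ → ℝ := fun k => F.Θ.indicator fun θ => 1 * F.bregman (t k) θ with hEdef
  set H : ℕ → ℝ → ℝ := fun k => F.Θ.indicator fun θ => r * F.bregman (t₀ k) θ with hHdef
  have hEΘ : ∀ k, ∀ θ ∈ F.Θ, E k θ = F.bregman (t k) θ := fun k θ hθ => by
    simp [hEdef, Set.indicator_of_mem hθ]
  have hHΘ : ∀ k, ∀ θ ∈ F.Θ, H k θ = r * F.bregman (t₀ k) θ := fun k θ hθ => by
    simp [hHdef, Set.indicator_of_mem hθ]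
  have hEm : ∀ k, Measurable (E k) := fun k => measurable_indicator_bregman _ _
  have hHm : ∀ k, Measurable (H k) := fun k => measurable_indicator_bregman _ _
  have hE : ∀ k, ∀ᵐ θ ∂μ, 0 ≤ E k θ := fun k => by
    filter_upwards [ae_mem_Θ] with θ hθ
    rw [hEΘ k θ hθ]
    exact F.bregman_nonneg (htΘ k) hθ
  have hH : ∀ k, ∀ᵐ θ ∂μ, 0 ≤ H k θ := fun k => by
    filter_upwards [ae_mem_Θ] with θ hθ
    rw [hHΘ k θ hθ]
    exact mul_nonneg hr.le (F.bregman_nonneg (ht₀Θ k) hθ)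
  have hexp : ∀ k, ∀ a ∈ Set.Ioc (0 : ℝ) 1,
      Integrable (fun θ => Real.exp (-(n₀ k * a * F.bregman (t₀ k) θ))) μ := fun k a ha =>
    integrable_exp_bregman hπ₀_meas hπ₀_nonneg (hn₀0 k) (hy₀ k) (hmean₀ k) (hc k a ha)
  have hint : ∀ k, ∀ a ∈ Set.Ioo (0 : ℝ) 1,
      Integrable (fun θ => Real.exp (-((n k : ℝ) * (a * H k θ)))) μ := fun k a ha => by
    refine (hexp k a ⟨ha.1, ha.2.le⟩).congr ?_
    filter_upwards [ae_mem_Θ] with θ hθ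
    rw [hHΘ k θ hθ, hnr]
    ring_nf
  -- V is a ball around the limit of t of radius at most δ/2. Since the limits are δ apart, points
  -- of V stay at distance at least δ/2 from the limit of t₀.
  have hsep : ∃ c > 0, ∃ V, MeasurableSet V ∧ μ V ≠ ⊤ ∧
      ∀ᶠ k in atTop, ∀ᵐ θ ∂μ, (θ ∉ V → c ≤ E k θ) ∧ (θ ∈ V → c ≤ H k θ) := by
    have hρ : 0 < min ρ₁ (δ / 2) := by positivity
    obtain ⟨c₁, hc₁, σ₁, hσ₁, h₁⟩ := exists_le_bregman hB hθlim hρ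
    obtain ⟨c₂, hc₂, σ₂, hσ₂, h₂⟩ := exists_le_bregman hB hθ₀lim (half_pos hδ)
    refine ⟨min c₁ (r * c₂), by positivity, Metric.ball θlim (min ρ₁ (δ / 2)),
      measurableSet_ball, (hball _ hρ (min_le_left _ _)).2, ?_⟩
    filter_upwards [hnear σ₁ hσ₁, hnear₀ σ₂ hσ₂] with k hk hk₀
    filter_upwards [ae_mem_Θ] with θ hθ
    rw [hEΘ k θ hθ, hHΘ k θ hθ, Metric.mem_ball, Real.dist_eq, not_lt]
    refine ⟨fun h => (min_le_left _ _).trans (h₁ _ hk θ hθ h), fun h => (min_le_right _ _).trans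
      (mul_le_mul_of_nonneg_left (h₂ _ hk₀ θ hθ ?_) hr.le)⟩
    have h3 : |θ - θlim| < δ / 2 := h.trans_le (min_le_right _ _)
    have h4 := abs_sub_le θlim θ θ₀lim
    rw [hlim, abs_sub_comm θlim θ] at h4
    linarith
  have hEmin : ∀ κ > 0, ∃ M, ∃ V, MeasurableSet V ∧ μ V ≠ 0 ∧ μ V ≠ ⊤ ∧
      ∀ᶠ k in atTop, ∀ᵐ θ ∂μ, θ ∈ V → E k θ ≤ κ ∧ H k θ ≤ M := by
    intro κ hκ
    obtain ⟨σ₁, hσ₁, h₁⟩ := exists_ball_bregman_le hθlim hθlim (K := κ) (by simpa [bregman])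
    obtain ⟨σ₂, hσ₂, h₂⟩ := exists_ball_bregman_le hθ₀lim hθlim (lt_add_one _)
    have hρ : 0 < min ρ₁ (min σ₁ σ₂) := by positivity
    have hb := hball _ hρ (min_le_left _ _)
    refine ⟨r * (F.bregman θ₀lim θlim + 1), Metric.ball θlim (min ρ₁ (min σ₁ σ₂)),
      measurableSet_ball, hb.1, hb.2, ?_⟩
    filter_upwards [hnear σ₁ hσ₁, hnear₀ σ₂ hσ₂] with k hk hk₀
    filter_upwards [ae_mem_Θ] with θ hθ hV
    rw [hEΘ k θ hθ, hHΘ k θ hθ]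
    exact ⟨h₁ _ hk θ (Metric.ball_subset_ball ((min_le_right _ _).trans (min_le_left _ _)) hV),
      mul_le_mul_of_nonneg_left (h₂ _ hk₀ θ (Metric.ball_subset_ball
        ((min_le_right _ _).trans (min_le_right _ _)) hV)) hr.le⟩
  have hHmin : ∀ κ > 0, ∃ V, MeasurableSet V ∧ μ V ≠ 0 ∧ μ V ≠ ⊤ ∧
      ∀ᶠ k in atTop, ∀ᵐ θ ∂μ, θ ∈ V → H k θ ≤ κ := by
    intro κ hκ
    have hκr : 0 < κ / r := by positivity
    obtain ⟨σ, hσ, h⟩ := exists_ball_bregman_le hθ₀lim hθ₀lim (K := κ / r) (by simpa [bregman])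
    have hρ : 0 < min ρ₂ σ := by positivity
    have hb := hball₀ _ hρ (min_le_left _ _)
    refine ⟨Metric.ball θ₀lim (min ρ₂ σ), measurableSet_ball, hb.1, hb.2, ?_⟩
    filter_upwards [hnear₀ σ hσ] with k hk
    filter_upwards [ae_mem_Θ] with θ hθ hV
    rw [hHΘ k θ hθ, ← le_div_iff₀' hr]
    exact h _ hk θ (Metric.ball_subset_ball (min_le_right _ _) hV)
  have htail : ∃ L, ∃ C > 0, ∀ᶠ k in atTop, Integrable (fun θ => Real.exp (-(L * H k θ))) μ ∧
      ∫ θ, Real.exp (-(L * H k θ)) ∂μ ≤ C := by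
    -- The divergence from every later t₀ dominates a multiple of that from the estimate with index
    -- 0, minus a constant. The exponent L is chosen so that the dominating function is a multiple
    -- of the integrand of c(1) for that one sample.
    obtain ⟨c, hc0, C₁, σ, hσ, h⟩ := exists_mul_bregman_sub_le hB hθ₀lim (ht₀Θ 0)
    have hdom := (hexp 0 1 ⟨one_pos, le_rfl⟩).const_mul (Real.exp (n₀ 0 / c * C₁))
    refine ⟨n₀ 0 / (c * r), (∫ θ, Real.exp (n₀ 0 / c * C₁) *
      Real.exp (-(n₀ 0 * 1 * F.bregman (t₀ 0) θ)) ∂μ) + 1,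
      add_pos_of_nonneg_of_pos (integral_nonneg fun θ => by positivity) one_pos, ?_⟩
    filter_upwards [hnear₀ σ hσ] with k hk
    have hle : ∀ᵐ θ ∂μ, Real.exp (-(n₀ 0 / (c * r) * H k θ)) ≤ Real.exp (n₀ 0 / c * C₁) *
        Real.exp (-(n₀ 0 * 1 * F.bregman (t₀ 0) θ)) := by
      filter_upwards [ae_mem_Θ] with θ hθ
      rw [hHΘ k θ hθ, ← Real.exp_add, Real.exp_le_exp]
      have h1 := mul_le_mul_of_nonneg_left (h _ hk θ hθ)
        (show (0 : ℝ) ≤ n₀ 0 / c by positivity)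
      have h2 : (n₀ 0 : ℝ) / c * (c * F.bregman (t₀ 0) θ - C₁) =
          n₀ 0 * F.bregman (t₀ 0) θ - n₀ 0 / c * C₁ := by field_simp
      have h3 : (n₀ 0 : ℝ) / (c * r) * (r * F.bregman (t₀ k) θ) =
          n₀ 0 / c * F.bregman (t₀ k) θ := by field_simp
      rw [h3]
      linarith
    have hi : Integrable (fun θ => Real.exp (-(n₀ 0 / (c * r) * H k θ))) μ := by
      refine hdom.mono' (by have := hHm k; fun_prop) ?_
      filter_upwards [hle] with θ hθ
      rwa [Real.norm_eq_abs, Real.abs_exp]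
    exact ⟨hi, (integral_mono_ae hi hdom hle).trans (by linarith)⟩
  obtain ⟨hposk, hmain⟩ := tendsto_integral_gibbsMean (N := fun k => (n k : ℝ)) hEm hHm
    (fun k => Nat.cast_nonneg _) (tendsto_natCast_atTop_atTop.comp hn) hE hH hint hsep hEmin hHmin
    htail (integrable_betaPDFReal hα₀ hβ₀)
    (fun a => by
      by_cases ha : 0 < a ∧ a < 1
      · exact (ProbabilityTheory.betaPDFReal_pos ha.1 ha.2 hα₀ hβ₀).le
      · simp [ProbabilityTheory.betaPDFReal, ha])
    (fun a ha => ProbabilityTheory.betaPDFReal_pos ha.1 ha.2 hα₀ hβ₀)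
    (fun a ha => if_neg ha) hε
  refine hmain.congr' ?_
  filter_upwards [hposk] with k hk
  have hA := F.likelihood_pos (hy k) (t k)
  have hker : ∀ a, F.marginalKernel π₀ α₀ β₀ (y k) (y₀ k) a = F.likelihood (y k) (t k) *
      (gibbsMean μ (E k) (H k) (n k) a * ProbabilityTheory.betaPDFReal α₀ β₀ a) := fun a =>
    marginalKernel_eq hπ₀_meas hπ₀_nonneg (hn0 k) (hn₀0 k) (hnr k) (hy₀ k) (hmean k) (hmean₀ k) a
  simp only [marginalPosterior, hker, intervalIntegral.integral_div,
    intervalIntegral.integral_const_mul]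
  -- The posterior's own normalizer cancels from the ratio only because it is nonzero, which holds
  -- for large k.
  rw [div_div_div_cancel_right₀ (mul_pos hA hk).ne', mul_div_mul_left _ _ hA.ne']
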